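/- Let $R$ be a ring with identity. For a left Gabriel filter $\mathcal F_l$ and a right Gabriel filter $\mathcal F_r$ on $R$, let the induced symmetric filter $_l\mathcal F_r$ be the Gabriel filter of all right ideals of $R\otimes_{\mathbb Z}R^{op}$ that contain $J\otimes R^{op}+R\otimes I$ for some $I\in\mathcal F_l$ and $J\in\mathcal F_r$. An $R$-bimodule $M$ is regarded as a right $R\otimes_{\mathbb Z}R^{op}$-module by $x(r\otimes s)=sxr$. Let $_lt_r(M)$ be its torsion submodule with respect to $_l\mathcal F_r$ (the elements annihilated by some member of $_l\mathcal F_r$); $M$ is torsion-free if $_lt_r(M)=0$, and $_l\mathcal F_r$ is faithful if the bimodule $R$ is torsion-free. The symmetric module of quotients is $$_lM_r=\varinjlim_{K\in\,_l\mathcal F_r}\operatorname{Hom}\bigl(K,\,M/\,_lt_r(M)\bigr),$$ with canonical map $q_M:M\to\,_lM_r$; $_lR_r$ is a ring, the symmetric ring of quotients. A derivation $\delta$ on $R$ is an additive map with $\delta(rs)=\delta(r)s+r\delta(s)$. It induces the derivation $\overline\delta(r\otimes s)=\delta(r)\otimes s+r\otimes\delta(s)$ of $R\otimes_{\mathbb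 Z}R^{op}$. A $\delta$-derivation on a bimodule $M$ is an additive map $d:M\to M$ with $d(xr)=d(x)r+x\delta(r)$ and $d(rx)=\delta(r)x+rd(x)$ for all $x\in M$, $r\in R$. The filter $_l\mathcal F_r$ is differential if for every derivation $\delta$ on $R$ and every $K\in\,_l\mathcal F_r$ there is $L\in\,_l\mathcal F_r$ with $\overline\delta(L)\subseteq K$. Let $_l\mathcal F_r^1\subseteq\,_l\mathcal F_r^2$ be symmetric filters induced by left and right Gabriel filters $\mathcal F_l^1,\mathcal F_r^1$ and $\mathcal F_l^2,\mathcal F_r^2$ on $R$. For a bimodule $M$ let $_lM_r^1$, $_lM_r^2$ be the symmetric modules of quotients, $q_i:M\to\,_lM_r^i$ the canonical maps, and $q_{12}:\,_lM_r^1\to\,_lM_r^2$ the natural map induced by the inclusion of filters, so that $q_{12}q_1=q_2$. **(a)** Suppose that $_l\mathcal F_r^1$ is differential, that $M$ is an $R$-bimodule, and that either i) $_lM_r^1$ is torsion-free with respect to $_l\mathcal F_r^2$, or ii) $_l\mathcal F_r^2$ is differential. Then for every derivation $\delta$ on $R$ and every $\delta$-derivation $d$ on $M$ there are $\delta$-derivations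 $d_1$ on $_lM_r^1$ and $d_2$ on $_lM_r^2$ that extend $d$ and agree, that is, $$d_1q_1=q_1d,\qquad d_2q_2=q_2d,\qquad d_2q_{12}=q_{12}d_1 .$$ **(b)** Suppose that either $_l\mathcal F_r^1$ is differential and i) or ii) holds for $M=R$, or iii) $_l\mathcal F_r^1$ and $_l\mathcal F_r^2$ are both faithful. Then every derivation $\delta$ on $R$ extends to derivations $d_1$ of the ring $_lR_r^1$ and $d_2$ of the ring $_lR_r^2$, which are also $\delta$-derivations of bimodules, and these extensions agree, that is, $d_1q_1=q_1\delta$, $d_2q_2=q_2\delta$ and $d_2q_{12}=q_{12}d_1$. -/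

import Mathlib

open scoped TensorProduct

noncomputable section

namespace TorsionQuotient

universe u v w

/-! ## Modules of quotients with respect to a Gabriel filter of left ideals -/

section Generic

variable {A : Type u} [Ring A] (F : IdealFilter A) [F.IsGabriel]

/-- The torsion submodule of a left module: all elements annihilated by a member of the filter. -/
def torsion (M : Type v) [AddCommGroup M] [Module A M] : Submodule A M where
  carrier := {m | F.IsTorsionElem m}
  add_mem' := by
    rintro x y ⟨I, hI, hx⟩ ⟨J, hJ, hy⟩
    exact ⟨I ⊓ J, F.inf_mem hI hJ, fun a ha => by rw [smul_add, hx a ha.1, hy a ha.2, add_zero]⟩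
  zero_mem' := ⟨⊤, F.top_mem, fun a _ => smul_zero a⟩
  smul_mem' := by
    rintro c x ⟨I, hI, hx⟩
    exact ⟨I.colon {c}, IdealFilter.IsUniform.colon_mem hI c, fun a ha => by
      rw [smul_smul]; exact hx _ (Submodule.mem_colon_singleton.mp ha)⟩

/-- A module is torsion-free if its torsion submodule is zero. -/
def IsTorsionFree (M : Type v) [AddCommGroup M] [Module A M] : Prop :=
  torsion F M = ⊥

/-- The members of the filter, ordered by reverse inclusion. -/
abbrev Index : Type u := {K : Ideal A // K ∈ F}ᵒᵈ

instance : Nonempty (Index F) := ⟨OrderDual.toDual ⟨⊤, F.top_mem⟩⟩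

instance : IsDirectedOrder (Index F) :=
  ⟨fun a b => ⟨OrderDual.toDual ⟨a.ofDual.1 ⊓ b.ofDual.1, F.inf_mem a.ofDual.2 b.ofDual.2⟩,
    (inf_le_left : a.ofDual.1 ⊓ b.ofDual.1 ≤ a.ofDual.1),
    (inf_le_right : a.ofDual.1 ⊓ b.ofDual.1 ≤ b.ofDual.1)⟩⟩

instance : DecidableEq (Index F) := Classical.decEq _

section

variable (M : Type v) [AddCommGroup M] [Module A M]

/-- The group `Hom_A(K, M / t(M))` for a member `K` of the filter. -/
abbrev HomAt (K : Index F) : Type (max u v) := (K.ofDual.1 : Ideal A) →ₗ[A] (M ⧸ torsion F M)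

/-- Restriction of homomorphisms to a smaller member of the filter. -/
def restr (K L : Index F) (h : K ≤ L) : HomAt F M K →+ HomAt F M L where
  toFun f := f ∘ₗ Submodule.inclusion (h : L.ofDual.1 ≤ K.ofDual.1)
  map_zero' := rfl
  map_add' _ _ := rfl

instance : DirectedSystem (HomAt F M) fun K L h => restr F M K L h where
  map_self _ _ := rfl
  map_map _ _ _ _ _ _ := rfl

/-- The module of quotients `M_F`, the direct limit of the groups `Hom_A(K, M / t(M))` over the
members `K` of the filter `F`. -/
def ModQuot : Type (max u v) := AddCommGroup.DirectLimit (HomAt F M) (restr F M)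

instance : AddCommGroup (ModQuot F M) :=
  inferInstanceAs (AddCommGroup (AddCommGroup.DirectLimit (HomAt F M) (restr F M)))

end

variable {F} {M : Type v} [AddCommGroup M] [Module A M]

/-- The class in `M_F` of a homomorphism `K → M / t(M)`. -/
def germ {K : Ideal A} (hK : K ∈ F) : (K →ₗ[A] (M ⧸ torsion F M)) →+ ModQuot F M :=
  AddCommGroup.DirectLimit.of (HomAt F M) (restr F M) (OrderDual.toDual ⟨K, hK⟩)

theorem exists_germ (z : ModQuot F M) :
    ∃ (K : Ideal A) (hK : K ∈ F) (f : K →ₗ[A] (M ⧸ torsion F M)), germ hK f = z := by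
  refine AddCommGroup.DirectLimit.induction_on z fun i x => ?_
  exact ⟨i.ofDual.1, i.ofDual.2, x, rfl⟩

theorem germ_restrict {K L : Ideal A} (hK : K ∈ F) (hL : L ∈ F) (h : L ≤ K)
    (f : K →ₗ[A] (M ⧸ torsion F M)) :
    germ hL (f ∘ₗ Submodule.inclusion h) = germ hK f :=
  AddCommGroup.DirectLimit.of_f (G := HomAt F M) (f := restr F M)
    (i := OrderDual.toDual ⟨K, hK⟩) (j := OrderDual.toDual ⟨L, hL⟩) h f

theorem germ_eq_of {K L P : Ideal A} (hK : K ∈ F) (hL : L ∈ F) (hP : P ∈ F)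
    {f : K →ₗ[A] (M ⧸ torsion F M)} {g : L →ₗ[A] (M ⧸ torsion F M)}
    (h : ∀ x (h₁ : x ∈ K) (h₂ : x ∈ L), x ∈ P → f ⟨x, h₁⟩ = g ⟨x, h₂⟩) :
    germ hK f = germ hL g := by
  have hW : K ⊓ L ⊓ P ∈ F := F.inf_mem (F.inf_mem hK hL) hP
  rw [← germ_restrict hK hW (inf_le_left.trans inf_le_left) f,
    ← germ_restrict hL hW (inf_le_left.trans inf_le_right) g]
  congr 1
  ext x
  exact h x.1 x.2.1.1 x.2.1.2 x.2.2

theorem germ_eq_zero {K : Ideal A} (hK : K ∈ F) {f : K →ₗ[A] (M ⧸ torsion F M)}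
    (h : germ hK f = 0) : ∃ L ∈ F, ∀ x (h₁ : x ∈ K), x ∈ L → f ⟨x, h₁⟩ = 0 := by
  obtain ⟨L, hL, e⟩ := AddCommGroup.DirectLimit.of.zero_exact (G := HomAt F M) (f := restr F M) _ _ h
  refine ⟨L.ofDual.1, L.ofDual.2, fun x h₁ h₂ => ?_⟩
  exact LinearMap.congr_fun e ⟨x, h₂⟩

/-- For `f : K → M / t(M)` the homomorphism `x ↦ f (x a)` on `(K : a) = {x | x a ∈ K}`. -/
def shift (a : A) (K : Ideal A) :
    (K →ₗ[A] (M ⧸ torsion F M)) →+ ((K.colon {a} : Ideal A) →ₗ[A] (M ⧸ torsion F M)) where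
  toFun f :=
    { toFun := fun x => f ⟨x.1 * a, Submodule.mem_colon_singleton.mp x.2⟩
      map_add' := fun x y => by rw [← map_add]; congr 1; ext; simp [add_mul]
      map_smul' := fun c x => by
        rw [RingHom.id_apply, ← map_smul]; congr 1; ext; simp [mul_assoc] }
  map_zero' := rfl
  map_add' _ _ := rfl

@[simp] theorem shift_apply (a : A) (K : Ideal A) (f : K →ₗ[A] (M ⧸ torsion F M))
    (x : (K.colon {a} : Ideal A)) :
    shift a K f x = f ⟨x.1 * a, Submodule.mem_colon_singleton.mp x.2⟩ := rfl

/-- Multiplication by `a` on `M_F`: the class of `f : K → M / t(M)` is sent to the class of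
`x ↦ f (x a)` on `(K : a)`. -/
def smulHom (a : A) : ModQuot F M →+ ModQuot F M :=
  AddCommGroup.DirectLimit.lift (HomAt F M) (restr F M) (ModQuot F M)
    (fun K => (germ (IdealFilter.IsUniform.colon_mem K.ofDual.2 a)).comp (shift a K.ofDual.1))
    (fun K L h f => by
      refine germ_eq_of _ _ F.top_mem fun x h₁ h₂ _ => ?_
      rfl)

theorem smulHom_germ (a : A) {K : Ideal A} (hK : K ∈ F) (f : K →ₗ[A] (M ⧸ torsion F M)) :
    smulHom a (germ hK f) = germ (IdealFilter.IsUniform.colon_mem hK a) (shift a K f) :=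
  AddCommGroup.DirectLimit.lift_of (G := HomAt F M) (f := restr F M) _ _ _
    (OrderDual.toDual ⟨K, hK⟩) f

instance : Module A (ModQuot F M) where
  smul a z := smulHom a z
  smul_zero a := map_zero (smulHom a)
  smul_add a := map_add (smulHom a)
  one_smul z := by
    obtain ⟨K, hK, f, rfl⟩ := exists_germ z
    refine (smulHom_germ _ _ _).trans (germ_eq_of _ _ F.top_mem fun x h₁ h₂ _ => ?_)
    simp
  mul_smul a b z := by
    obtain ⟨K, hK, f, rfl⟩ := exists_germ z
    change smulHom (a * b) _ = smulHom a (smulHom b _)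
    rw [smulHom_germ, smulHom_germ, smulHom_germ]
    refine germ_eq_of _ _ F.top_mem fun x h₁ h₂ _ => ?_
    simp [mul_assoc]
  add_smul a b z := by
    obtain ⟨K, hK, f, rfl⟩ := exists_germ z
    change smulHom (a + b) _ = smulHom a _ + smulHom b _
    rw [smulHom_germ, smulHom_germ, smulHom_germ]
    have ha := IdealFilter.IsUniform.colon_mem hK a
    have hb := IdealFilter.IsUniform.colon_mem hK b
    have hW := F.inf_mem ha hb
    rw [← germ_restrict ha hW inf_le_left, ← germ_restrict hb hW inf_le_right, ← map_add]
    refine germ_eq_of _ _ F.top_mem fun x h₁ h₂ _ => ?_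
    simp only [shift_apply, LinearMap.add_apply, LinearMap.comp_apply]
    rw [← map_add]
    congr 1
    ext
    simp [mul_add]
  zero_smul z := by
    obtain ⟨K, hK, f, rfl⟩ := exists_germ z
    refine (smulHom_germ _ _ _).trans ?_
    rw [← map_zero (germ (M := M) F.top_mem)]
    refine germ_eq_of _ _ F.top_mem fun x h₁ h₂ _ => ?_
    simp only [shift_apply, mul_zero, LinearMap.zero_apply]
    exact map_zero f

theorem smul_germ (a : A) {K : Ideal A} (hK : K ∈ F) (f : K →ₗ[A] (M ⧸ torsion F M)) :
    a • germ hK f = germ (IdealFilter.IsUniform.colon_mem hK a) (shift a K f) :=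
  smulHom_germ a hK f

variable (F M)

/-- The map `M / t(M) → M_F` sending an element `y` to the class of `x ↦ x y`. -/
def iota : (M ⧸ torsion F M) →ₗ[A] ModQuot F M where
  toFun y := germ F.top_mem ((LinearMap.toSpanSingleton A _ y) ∘ₗ Submodule.subtype ⊤)
  map_add' y z := by
    rw [← map_add]; congr 1; ext x; simp
  map_smul' a y := by
    rw [RingHom.id_apply, smul_germ]
    refine germ_eq_of _ _ F.top_mem fun x h₁ h₂ _ => ?_
    simp [mul_smul]

/-- The canonical map `q_M : M → M_F`. -/
def toQuot : M →ₗ[A] ModQuot F M := iota F M ∘ₗ (torsion F M).mkQ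

variable {F M}

theorem smul_germ_mem {K : Ideal A} (hK : K ∈ F) (f : K →ₗ[A] (M ⧸ torsion F M))
    (a : A) (ha : a ∈ K) : a • germ hK f = iota F M (f ⟨a, ha⟩) := by
  rw [smul_germ]
  refine germ_eq_of _ _ F.top_mem fun x h₁ h₂ _ => ?_
  simp only [shift_apply, LinearMap.comp_apply, LinearMap.toSpanSingleton_apply,
    Submodule.subtype_apply]
  rw [← map_smul]
  rfl

theorem eq_zero_of_iota {y : M ⧸ torsion F M} (h : iota F M y = 0) : y = 0 := by
  obtain ⟨L, hL, e⟩ := germ_eq_zero _ h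
  obtain ⟨m, rfl⟩ := Submodule.Quotient.mk_surjective _ y
  rw [Submodule.Quotient.mk_eq_zero]
  -- `m` is torsion because the ideal annihilating it belongs to the filter
  refine ⟨LinearMap.ker (LinearMap.toSpanSingleton A M m),
    IdealFilter.IsGabriel.gabriel_closed _ ⟨L, hL, fun x hx => ?_⟩, fun a ha => by simpa using ha⟩
  have := e x trivial hx
  simp only [LinearMap.comp_apply, LinearMap.toSpanSingleton_apply, Submodule.subtype_apply,
    ← Submodule.Quotient.mk_smul, Submodule.Quotient.mk_eq_zero] at this
  obtain ⟨J, hJ, h⟩ := this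
  refine Order.PFilter.mem_of_le (fun a ha => ?_) hJ
  rw [Submodule.mem_colon_singleton]
  simpa [mul_smul] using h a ha

theorem iota_injective : Function.Injective (iota F M) :=
  (injective_iff_map_eq_zero _).mpr fun _ => eq_zero_of_iota

theorem toQuot_eq_zero {m : M} : toQuot F M m = 0 ↔ F.IsTorsionElem m := by
  constructor
  · intro h
    exact (Submodule.Quotient.mk_eq_zero (torsion F M)).mp (eq_zero_of_iota h)
  · intro h
    have : (torsion F M).mkQ m = 0 := (Submodule.Quotient.mk_eq_zero (torsion F M)).mpr h
    simp [toQuot, this]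

/-- The cokernel of `q_M` is torsion. -/
theorem exists_smul_mem_range (z : ModQuot F M) :
    ∃ K ∈ F, ∀ a ∈ K, ∃ m, a • z = toQuot F M m := by
  obtain ⟨K, hK, f, rfl⟩ := exists_germ z
  refine ⟨K, hK, fun a ha => ?_⟩
  obtain ⟨m, hm⟩ := Submodule.Quotient.mk_surjective _ (f ⟨a, ha⟩)
  exact ⟨m, by rw [smul_germ_mem hK f a ha, ← hm]; rfl⟩

/-- `M_F` is torsion-free. -/
theorem eq_zero_of_smul {L : Ideal A} (hL : L ∈ F) {z : ModQuot F M} (h : ∀ a ∈ L, a • z = 0) :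
    z = 0 := by
  obtain ⟨K, hK, f, rfl⟩ := exists_germ z
  rw [← map_zero (germ (M := M) hK)]
  refine germ_eq_of _ _ hL fun x h₁ h₂ hx => ?_
  have := h x hx
  rw [smul_germ_mem hK f x h₁] at this
  exact eq_zero_of_iota this

theorem eq_of_smul {L : Ideal A} (hL : L ∈ F) {z w : ModQuot F M}
    (h : ∀ a ∈ L, a • z = a • w) : z = w :=
  sub_eq_zero.mp (eq_zero_of_smul hL fun a ha => by rw [smul_sub, h a ha, sub_self])

/-- Every homomorphism from a member of the filter to `M_F` is a multiplication. -/
theorem exists_eq_smul {K : Ideal A} (hK : K ∈ F) (h : K →ₗ[A] ModQuot F M) :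
    ∃ z : ModQuot F M, ∀ a (ha : a ∈ K), a • z = h ⟨a, ha⟩ := by
  let L : Ideal A := ((LinearMap.range (iota F M)).comap h).map K.subtype
  have memL : ∀ x, x ∈ L ↔ ∃ hx : x ∈ K, h ⟨x, hx⟩ ∈ LinearMap.range (iota F M) := by
    intro x
    simp [L]
  have hL : L ∈ F := by
    refine IdealFilter.IsGabriel.gabriel_closed _ ⟨K, hK, fun x hx => ?_⟩
    obtain ⟨J, hJ, e⟩ := exists_smul_mem_range (h ⟨x, hx⟩)
    refine Order.PFilter.mem_of_le (fun a ha => ?_) hJ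
    rw [Submodule.mem_colon_singleton, memL]
    obtain ⟨m, hm⟩ := e a ha
    refine ⟨K.mul_mem_left a hx, (torsion F M).mkQ m, ?_⟩
    have : (⟨a • x, K.mul_mem_left a hx⟩ : K) = a • ⟨x, hx⟩ := rfl
    rw [this, map_smul, hm]
    rfl
  have hLK : L ≤ K := fun x hx => ((memL x).mp hx).1
  let e := LinearEquiv.ofInjective (iota F M) iota_injective
  let f : L →ₗ[A] (M ⧸ torsion F M) := e.symm.toLinearMap ∘ₗ
    LinearMap.codRestrict (LinearMap.range (iota F M)) (h ∘ₗ Submodule.inclusion hLK)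
      (fun x => ((memL x.1).mp x.2).2)
  have hf : ∀ x (hx : x ∈ L), x • germ hL f = h ⟨x, hLK hx⟩ := by
    intro x hx
    rw [smul_germ_mem hL f x hx]
    exact congrArg Subtype.val (e.apply_symm_apply _)
  refine ⟨germ hL f, fun a ha => ?_⟩
  refine eq_of_smul (IdealFilter.IsUniform.colon_mem hL a) fun b hb => ?_
  have hb' : b * a ∈ L := Submodule.mem_colon_singleton.mp hb
  rw [smul_smul, hf _ hb', ← map_smul]
  rfl

/-! ### Passing to a larger filter -/

section Transition

variable {G : IdealFilter A} [G.IsGabriel] (h : F ≤ G) (M)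

/-- The natural map `M / t_F(M) → M / t_G(M)` for filters `F ⊆ G`. -/
def torsionFactor : (M ⧸ torsion F M) →ₗ[A] (M ⧸ torsion G M) :=
  Submodule.factor (show torsion F M ≤ torsion G M from fun _ ⟨L, hL, hx⟩ => ⟨L, h hL, hx⟩)

/-- Composition of a homomorphism `K → M / t_F(M)` with `M / t_F(M) → M / t_G(M)`. -/
def postFactor (K : Ideal A) :
    (K →ₗ[A] (M ⧸ torsion F M)) →+ (K →ₗ[A] (M ⧸ torsion G M)) where
  toFun f := torsionFactor M h ∘ₗ f
  map_zero' := LinearMap.comp_zero _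
  map_add' _ _ := LinearMap.comp_add _ _ _

/-- The natural map `M_F → M_G` for filters `F ⊆ G`: the class of `f : K → M / t_F(M)` is sent to
the class of the composition of `f` with `M / t_F(M) → M / t_G(M)`. -/
def transitionHom : ModQuot F M →+ ModQuot G M :=
  AddCommGroup.DirectLimit.lift (HomAt F M) (restr F M) (ModQuot G M)
    (fun K => (germ (h K.ofDual.2)).comp (postFactor M h K.ofDual.1))
    (fun K L h' f => germ_restrict (h K.ofDual.2) (h L.ofDual.2) h' (torsionFactor M h ∘ₗ f))

theorem transitionHom_germ {K : Ideal A} (hK : K ∈ F) (f : K →ₗ[A] (M ⧸ torsion F M)) :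
    transitionHom M h (germ hK f) = germ (h hK) (torsionFactor M h ∘ₗ f) :=
  AddCommGroup.DirectLimit.lift_of (G := HomAt F M) (f := restr F M) _ _ _
    (OrderDual.toDual ⟨K, hK⟩) f

theorem transitionHom_smul (a : A) (z : ModQuot F M) :
    transitionHom M h (a • z) = a • transitionHom M h z := by
  obtain ⟨K, hK, f, rfl⟩ := exists_germ z
  rw [smul_germ, transitionHom_germ, transitionHom_germ, smul_germ]
  exact germ_eq_of _ _ G.top_mem fun _ _ _ _ => rfl

theorem transitionHom_toQuot (m : M) : transitionHom M h (toQuot F M m) = toQuot G M m := by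
  refine (transitionHom_germ M h _ _).trans ?_
  refine germ_eq_of _ _ G.top_mem fun x _ _ _ => ?_
  simp only [LinearMap.comp_apply, LinearMap.toSpanSingleton_apply, Submodule.subtype_apply,
    map_smul]
  rfl

end Transition

/-! ### Extension of homomorphisms -/

section Extend

variable {N : Type*} {P : Type*} [AddCommGroup N] [Module A N] [AddCommGroup P] [Module A P]
  {φ : N →ₗ[A] P}

theorem hom_ext_of_torsion (hc : ∀ p : P, ∃ K ∈ F, ∀ a ∈ K, ∃ n, a • p = φ n)
    {g g' : P →ₗ[A] ModQuot F M} (h : ∀ n, g (φ n) = g' (φ n)) : g = g' := by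
  ext p
  obtain ⟨K, hK, e⟩ := hc p
  refine eq_of_smul hK fun a ha => ?_
  obtain ⟨n, hn⟩ := e a ha
  rw [← map_smul, ← map_smul, hn, h]

theorem exists_extension (hk : ∀ n, φ n = 0 → F.IsTorsionElem n)
    (hc : ∀ p : P, ∃ K ∈ F, ∀ a ∈ K, ∃ n, a • p = φ n) (g : N →ₗ[A] ModQuot F M) :
    ∃ g' : P →ₗ[A] ModQuot F M, ∀ n, g' (φ n) = g n := by
  have hg : ∀ n n', φ n = φ n' → g n = g n' := by
    intro n n' e
    obtain ⟨L, hL, h⟩ := hk (n - n') (by rw [map_sub, e, sub_self])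
    refine eq_of_smul hL fun a ha => ?_
    rw [← sub_eq_zero, ← smul_sub, ← map_sub, ← map_smul, h a ha, map_zero]
  have key : ∀ p : P, ∃ z : ModQuot F M, ∀ (a : A) (n : N), a • p = φ n → a • z = g n := by
    intro p
    let K : Ideal A := (LinearMap.range φ).comap (LinearMap.toSpanSingleton A P p)
    have hK : K ∈ F := by
      obtain ⟨K', hK', e⟩ := hc p
      refine Order.PFilter.mem_of_le (fun a ha => ?_) hK'
      obtain ⟨n, hn⟩ := e a ha
      exact ⟨n, by simpa using hn.symm⟩
    have hK' : ∀ a : K, ∃ n, φ n = a.1 • p := fun a => by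
      obtain ⟨n, hn⟩ := a.2
      exact ⟨n, by simpa using hn⟩
    choose n hn using hK'
    let h : K →ₗ[A] ModQuot F M :=
      { toFun := fun a => g (n a)
        map_add' := fun a b => by
          rw [← map_add]
          exact hg _ _ (by rw [map_add, hn, hn, hn, ← add_smul]; rfl)
        map_smul' := fun c a => by
          rw [RingHom.id_apply, ← map_smul]
          exact hg _ _ (by rw [map_smul, hn, hn, smul_smul]; rfl) }
    obtain ⟨z, hz⟩ := exists_eq_smul hK h
    refine ⟨z, fun a m ham => ?_⟩
    have ha : a ∈ K := ⟨m, by simpa using ham.symm⟩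
    rw [hz a ha]
    exact hg _ _ (by rw [hn, ham])
  choose z hz using key
  refine ⟨{ toFun := z, map_add' := fun p p' => ?_, map_smul' := fun c p => ?_ }, fun n => ?_⟩
  · obtain ⟨K, hK, e⟩ := hc p
    obtain ⟨K', hK', e'⟩ := hc p'
    refine eq_of_smul (F.inf_mem hK hK') fun a ha => ?_
    obtain ⟨n, hn⟩ := e a ha.1
    obtain ⟨n', hn'⟩ := e' a ha.2
    rw [smul_add a (z p), hz p a n hn, hz p' a n' hn', ← map_add]
    exact hz _ _ _ (by rw [smul_add, hn, hn', map_add])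
  · obtain ⟨K, hK, e⟩ := hc p
    refine eq_of_smul (IdealFilter.IsUniform.colon_mem hK c) fun a ha => ?_
    obtain ⟨n, hn⟩ := e _ (Submodule.mem_colon_singleton.mp ha)
    rw [RingHom.id_apply, smul_smul, ← smul_eq_mul, hz p _ n hn]
    exact hz _ _ _ (by rw [smul_smul]; exact hn)
  · change z (φ n) = g n
    rw [← one_smul A (z (φ n))]
    exact hz _ _ _ (one_smul A _)

end Extend

end Generic
/-! ## Bimodules and symmetric filters -/

section Bimodule

open MulOpposite

variable (R : Type u) [Ring R]

/-- The enveloping ring `R ⊗ Rᵒᵖ`. An `R`-bimodule is a left module over it through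
`(r ⊗ s) x = r x s`. The swap of factors is an anti-isomorphism of this ring, so its left modules,
left ideals and filters of left ideals are the same as the right ones with the action
`x (r ⊗ s) = s x r`. -/
abbrev Env : Type u := R ⊗[ℤ] Rᵐᵒᵖ

variable {R}

/-- The ring homomorphism `r ↦ r ⊗ 1`. -/
def leftHom : R →+* Env R := Algebra.TensorProduct.includeLeftRingHom

/-- The ring homomorphism `s ↦ 1 ⊗ s`. -/
def rightHom : Rᵐᵒᵖ →+* Env R := (Algebra.TensorProduct.includeRight : Rᵐᵒᵖ →ₐ[ℤ] Env R).toRingHom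

theorem leftHom_apply (r : R) : leftHom r = (r ⊗ₜ[ℤ] 1 : Env R) := rfl

theorem rightHom_apply (s : Rᵐᵒᵖ) : rightHom s = ((1 : R) ⊗ₜ[ℤ] s : Env R) := rfl

theorem leftHom_mul_rightHom (r : R) (s : Rᵐᵒᵖ) :
    leftHom r * rightHom s = (r ⊗ₜ[ℤ] s : Env R) := by
  simp [leftHom_apply, rightHom_apply]

theorem rightHom_mul_leftHom (r : R) (s : Rᵐᵒᵖ) :
    rightHom s * leftHom r = (r ⊗ₜ[ℤ] s : Env R) := by
  simp [leftHom_apply, rightHom_apply]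

/-- The symmetric filter induced by a filter `Fl` of left ideals of `R` and a filter `Fr` of right
ideals of `R` (that is, of left ideals of `Rᵒᵖ`): it consists of the ideals of the enveloping ring
that contain (the image of) `I ⊗ Rᵒᵖ + R ⊗ J` for some `I ∈ Fl` and `J ∈ Fr`. -/
def symmetricFilter (Fl : IdealFilter R) (Fr : IdealFilter Rᵐᵒᵖ) : IdealFilter (Env R) :=
  Order.IsPFilter.toPFilter
    (F := {K : Ideal (Env R) | ∃ I ∈ Fl, ∃ J ∈ Fr, I.map leftHom ⊔ J.map rightHom ≤ K})
    (Order.IsPFilter.of_def ⟨⊤, ⊤, Fl.top_mem, ⊤, Fr.top_mem, le_top⟩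
      (by
        rintro K ⟨I, hI, J, hJ, h⟩ K' ⟨I', hI', J', hJ', h'⟩
        refine ⟨K ⊓ K', ⟨I ⊓ I', Fl.inf_mem hI hI', J ⊓ J', Fr.inf_mem hJ hJ', ?_⟩,
          inf_le_left, inf_le_right⟩
        exact le_inf ((sup_le_sup (Ideal.map_mono inf_le_left) (Ideal.map_mono inf_le_left)).trans h)
          ((sup_le_sup (Ideal.map_mono inf_le_right) (Ideal.map_mono inf_le_right)).trans h'))
      (by
        rintro K K' hK ⟨I, hI, J, hJ, h⟩
        exact ⟨I, hI, J, hJ, h.trans hK⟩))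

theorem mem_symmetricFilter {Fl : IdealFilter R} {Fr : IdealFilter Rᵐᵒᵖ} {K : Ideal (Env R)} :
    K ∈ symmetricFilter Fl Fr ↔ ∃ I ∈ Fl, ∃ J ∈ Fr, I.map leftHom ⊔ J.map rightHom ≤ K :=
  Iff.rfl

theorem mem_symmetricFilter_iff {Fl : IdealFilter R} {Fr : IdealFilter Rᵐᵒᵖ} {K : Ideal (Env R)} :
    K ∈ symmetricFilter Fl Fr ↔ K.comap leftHom ∈ Fl ∧ K.comap rightHom ∈ Fr := by
  rw [mem_symmetricFilter]
  constructor
  · rintro ⟨I, hI, J, hJ, h⟩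
    rw [sup_le_iff, Ideal.map_le_iff_le_comap, Ideal.map_le_iff_le_comap] at h
    exact ⟨Order.PFilter.mem_of_le h.1 hI, Order.PFilter.mem_of_le h.2 hJ⟩
  · rintro ⟨hI, hJ⟩
    exact ⟨_, hI, _, hJ, sup_le (Ideal.map_comap_le) (Ideal.map_comap_le)⟩

variable (Fl : IdealFilter R) (Fr : IdealFilter Rᵐᵒᵖ) [Fl.IsGabriel] [Fr.IsGabriel]

instance : (symmetricFilter Fl Fr).IsGabriel where
  colon_mem := by
    intro K hK t
    induction t using TensorProduct.induction_on with
    | zero =>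
      refine Order.PFilter.mem_of_le (fun a _ => ?_) hK
      rw [Submodule.mem_colon_singleton, smul_zero]
      exact K.zero_mem
    | tmul r s =>
      rw [mem_symmetricFilter_iff] at hK ⊢
      constructor
      · refine Order.PFilter.mem_of_le (fun a ha => ?_) (IdealFilter.IsUniform.colon_mem hK.1 r)
        rw [Submodule.mem_colon_singleton, Ideal.mem_comap] at ha
        rw [Ideal.mem_comap, Submodule.mem_colon_singleton, ← leftHom_mul_rightHom, smul_eq_mul,
          ← mul_assoc, ← map_mul, leftHom_mul_rightHom, ← rightHom_mul_leftHom]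
        exact K.mul_mem_left _ ha
      · refine Order.PFilter.mem_of_le (fun a ha => ?_) (IdealFilter.IsUniform.colon_mem hK.2 s)
        rw [Submodule.mem_colon_singleton, Ideal.mem_comap] at ha
        rw [Ideal.mem_comap, Submodule.mem_colon_singleton, ← rightHom_mul_leftHom, smul_eq_mul,
          ← mul_assoc, ← map_mul, rightHom_mul_leftHom, ← leftHom_mul_rightHom]
        exact K.mul_mem_left _ ha
    | add t t' ht ht' =>
      refine Order.PFilter.mem_of_le (fun a ha => ?_) ((symmetricFilter Fl Fr).inf_mem ht ht')
      rw [Submodule.mem_colon_singleton, smul_add]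
      exact K.add_mem (Submodule.mem_colon_singleton.mp ha.1)
        (Submodule.mem_colon_singleton.mp ha.2)
  gabriel_closed := by
    rintro L ⟨K, hK, h⟩
    rw [mem_symmetricFilter_iff] at hK ⊢
    constructor
    · refine IdealFilter.IsGabriel.gabriel_closed _ ⟨_, hK.1, fun x hx => ?_⟩
      refine Order.PFilter.mem_of_le (fun a ha => ?_) (mem_symmetricFilter_iff.mp (h _ hx)).1
      rw [Ideal.mem_comap, Submodule.mem_colon_singleton] at ha
      rw [Submodule.mem_colon_singleton, Ideal.mem_comap, smul_eq_mul, map_mul]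
      exact ha
    · refine IdealFilter.IsGabriel.gabriel_closed _ ⟨_, hK.2, fun x hx => ?_⟩
      refine Order.PFilter.mem_of_le (fun a ha => ?_) (mem_symmetricFilter_iff.mp (h _ hx)).2
      rw [Ideal.mem_comap, Submodule.mem_colon_singleton] at ha
      rw [Submodule.mem_colon_singleton, Ideal.mem_comap, smul_eq_mul, map_mul]
      exact ha

/-! ### Symmetric modules of quotients -/

section Quotients

attribute [local instance] TensorProduct.Algebra.module

variable (M : Type v) [AddCommGroup M] [Module R M] [Module Rᵐᵒᵖ M] [SMulCommClass R Rᵐᵒᵖ M]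

theorem leftHom_smul (r : R) (x : M) : leftHom r • x = r • x := by
  rw [leftHom_apply, TensorProduct.Algebra.smul_def, one_smul]

theorem rightHom_smul (s : Rᵐᵒᵖ) (x : M) : rightHom s • x = s • x := by
  rw [rightHom_apply, TensorProduct.Algebra.smul_def, one_smul]

/-- An `R`-bimodule is torsion-free for the symmetric filter if it has no nonzero element
annihilated by a member of the filter. -/
def SymTorsionFree : Prop := IsTorsionFree (symmetricFilter Fl Fr) M

/-- The symmetric module of quotients of an `R`-bimodule `M`: the direct limit of the groups of
bimodule homomorphisms `K → M / t(M)` over the members `K` of the symmetric filter. -/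
def SymQuot : Type (max u v) := ModQuot (symmetricFilter Fl Fr) M

instance : AddCommGroup (SymQuot Fl Fr M) :=
  inferInstanceAs (AddCommGroup (ModQuot (symmetricFilter Fl Fr) M))

/-- The action of the enveloping ring. -/
instance : Module (Env R) (SymQuot Fl Fr M) :=
  inferInstanceAs (Module (Env R) (ModQuot (symmetricFilter Fl Fr) M))

/-- The left action `r z = (r ⊗ 1) z`. -/
instance : Module R (SymQuot Fl Fr M) := Module.compHom _ leftHom

/-- The right action `z s = (1 ⊗ s) z`. -/
instance : Module Rᵐᵒᵖ (SymQuot Fl Fr M) := Module.compHom _ rightHom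

instance : SMulCommClass R Rᵐᵒᵖ (SymQuot Fl Fr M) where
  smul_comm r s z := by
    change leftHom r • rightHom s • z = rightHom s • leftHom r • z
    rw [smul_smul, smul_smul, leftHom_mul_rightHom, rightHom_mul_leftHom]

/-- The canonical map `q_M` from `M` to its symmetric module of quotients. -/
def toSymQuot : M →+ SymQuot Fl Fr M := (toQuot (symmetricFilter Fl Fr) M).toAddMonoidHom

/-- The canonical map `q₁₂` between the symmetric modules of quotients for symmetric filters such
that the first is contained in the second. -/
def symTransition {Fl₁ Fl₂ : IdealFilter R} {Fr₁ Fr₂ : IdealFilter Rᵐᵒᵖ}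
    [Fl₁.IsGabriel] [Fl₂.IsGabriel] [Fr₁.IsGabriel] [Fr₂.IsGabriel]
    (h : symmetricFilter Fl₁ Fr₁ ≤ symmetricFilter Fl₂ Fr₂) :
    SymQuot Fl₁ Fr₁ M →+ SymQuot Fl₂ Fr₂ M :=
  transitionHom M h

/-- `q₁₂ q₁ = q₂`. -/
theorem symTransition_toSymQuot {Fl₁ Fl₂ : IdealFilter R} {Fr₁ Fr₂ : IdealFilter Rᵐᵒᵖ}
    [Fl₁.IsGabriel] [Fl₂.IsGabriel] [Fr₁.IsGabriel] [Fr₂.IsGabriel]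
    (h : symmetricFilter Fl₁ Fr₁ ≤ symmetricFilter Fl₂ Fr₂) (m : M) :
    symTransition M h (toSymQuot Fl₁ Fr₁ M m) = toSymQuot Fl₂ Fr₂ M m :=
  transitionHom_toQuot M h m

variable {Fl Fr M}

theorem toSymQuot_smul (r : R) (m : M) :
    toSymQuot Fl Fr M (r • m) = r • toSymQuot Fl Fr M m := by
  rw [← leftHom_smul M r m]
  exact map_smul (toQuot (symmetricFilter Fl Fr) M) (leftHom r) m

theorem toSymQuot_op_smul (s : Rᵐᵒᵖ) (m : M) :
    toSymQuot Fl Fr M (s • m) = s • toSymQuot Fl Fr M m := by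
  rw [← rightHom_smul M s m]
  exact map_smul (toQuot (symmetricFilter Fl Fr) M) (rightHom s) m

theorem exists_left_of_toSymQuot_eq_zero {m : M} (h : toSymQuot Fl Fr M m = 0) :
    Fl.IsTorsionElem m := by
  obtain ⟨K, hK, e⟩ := toQuot_eq_zero.mp h
  exact ⟨_, (mem_symmetricFilter_iff.mp hK).1, fun a ha => by rw [← leftHom_smul]; exact e _ ha⟩

theorem exists_right_of_toSymQuot_eq_zero {m : M} (h : toSymQuot Fl Fr M m = 0) :
    Fr.IsTorsionElem m := by
  obtain ⟨K, hK, e⟩ := toQuot_eq_zero.mp h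
  exact ⟨_, (mem_symmetricFilter_iff.mp hK).2, fun a ha => by rw [← rightHom_smul]; exact e _ ha⟩

theorem exists_left_smul_mem (z : SymQuot Fl Fr M) :
    ∃ I ∈ Fl, ∀ a ∈ I, ∃ m, a • z = toSymQuot Fl Fr M m := by
  obtain ⟨K, hK, e⟩ := exists_smul_mem_range (F := symmetricFilter Fl Fr) (M := M) z
  exact ⟨_, (mem_symmetricFilter_iff.mp hK).1, fun a ha => e _ ha⟩

theorem exists_right_smul_mem (z : SymQuot Fl Fr M) :
    ∃ J ∈ Fr, ∀ a ∈ J, ∃ m, a • z = toSymQuot Fl Fr M m := by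
  obtain ⟨K, hK, e⟩ := exists_smul_mem_range (F := symmetricFilter Fl Fr) (M := M) z
  exact ⟨_, (mem_symmetricFilter_iff.mp hK).2, fun a ha => e _ ha⟩

/-- An element of the symmetric module of quotients that is torsion on both sides is zero. -/
theorem sym_eq_zero {z : SymQuot Fl Fr M} (hl : Fl.IsTorsionElem z) (hr : Fr.IsTorsionElem z) :
    z = 0 := by
  obtain ⟨I, hI, h⟩ := hl
  obtain ⟨J, hJ, h'⟩ := hr
  let K : Ideal (Env R) := LinearMap.ker (LinearMap.toSpanSingleton (Env R) (SymQuot Fl Fr M) z)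
  have hK : K ∈ symmetricFilter Fl Fr := by
    rw [mem_symmetricFilter_iff]
    refine ⟨Order.PFilter.mem_of_le (fun a ha => ?_) hI,
      Order.PFilter.mem_of_le (fun a ha => ?_) hJ⟩
    · rw [Ideal.mem_comap, LinearMap.mem_ker, LinearMap.toSpanSingleton_apply]
      exact h a ha
    · rw [Ideal.mem_comap, LinearMap.mem_ker, LinearMap.toSpanSingleton_apply]
      exact h' a ha
  exact eq_zero_of_smul (F := symmetricFilter Fl Fr) (M := M) hK fun a ha => ha

theorem sym_ext {z w : SymQuot Fl Fr M} {I : Ideal R} {J : Ideal Rᵐᵒᵖ} (hI : I ∈ Fl) (hJ : J ∈ Fr)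
    (hl : ∀ a ∈ I, a • z = a • w) (hr : ∀ a ∈ J, a • z = a • w) : z = w :=
  sub_eq_zero.mp (sym_eq_zero ⟨I, hI, fun a ha => by rw [smul_sub, hl a ha, sub_self]⟩
    ⟨J, hJ, fun a ha => by rw [smul_sub, hr a ha, sub_self]⟩)

end Quotients

/-! ### The symmetric ring of quotients -/

section Ring

variable {Fl : IdealFilter R} {Fr : IdealFilter Rᵐᵒᵖ} [Fl.IsGabriel] [Fr.IsGabriel]

theorem env_smul_left (r : R) (z : SymQuot Fl Fr R) : leftHom r • z = r • z := rfl

theorem env_smul_right (s : Rᵐᵒᵖ) (z : SymQuot Fl Fr R) : rightHom s • z = s • z := rfl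

theorem tmul_smul (r : R) (s : Rᵐᵒᵖ) (z : SymQuot Fl Fr R) :
    (r ⊗ₜ[ℤ] s : Env R) • z = r • s • z := by
  rw [← leftHom_mul_rightHom, mul_smul, env_smul_left, env_smul_right]

theorem toSymQuot_mul (r r' : R) :
    toSymQuot Fl Fr R (r * r') = r • toSymQuot Fl Fr R r' := toSymQuot_smul r r'

theorem toSymQuot_mul' (r r' : R) :
    toSymQuot Fl Fr R (r * r') = op r' • toSymQuot Fl Fr R r := toSymQuot_op_smul (op r') r

/-- The defining property of the product `s = p q` in the symmetric ring of quotients: if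
`a p = r` lies in (the image of) `R` then `a s = r q`, and if `q b = r` lies in `R` then
`s b = p r`. -/
def IsProduct (p q s : SymQuot Fl Fr R) : Prop :=
  (∀ a r : R, a • p = toSymQuot Fl Fr R r → a • s = r • q) ∧
    ∀ b r : R, op b • q = toSymQuot Fl Fr R r → op b • s = op r • p

/-- Pairs `(t, z)` such that `t (p q) = z` has to hold. -/
def prodGens (p q : SymQuot Fl Fr R) : Set (Env R × SymQuot Fl Fr R) :=
  {x | (∃ a r : R, a • p = toSymQuot Fl Fr R r ∧ x = (leftHom a, r • q)) ∨
    ∃ b r : R, op b • q = toSymQuot Fl Fr R r ∧ x = (rightHom (op b), op r • p)}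

/-- Additive families of homomorphisms extend along a map with torsion kernel and cokernel. -/
theorem exists_biext {A : Type u} [Ring A] (F : IdealFilter A) [F.IsGabriel]
    {N P M S : Type*} [AddCommGroup N] [Module A N] [AddCommGroup P] [Module A P]
    [AddCommGroup M] [Module A M] [AddCommGroup S] (φ : N →ₗ[A] P)
    (hk : ∀ n, φ n = 0 → F.IsTorsionElem n)
    (hc : ∀ p : P, ∃ K ∈ F, ∀ a ∈ K, ∃ n, a • p = φ n) (g : S → N →ₗ[A] ModQuot F M)
    (hg : ∀ s s' n, g (s + s') n = g s n + g s' n) :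
    ∃ ρ : S → P →ₗ[A] ModQuot F M,
      (∀ s n, ρ s (φ n) = g s n) ∧ ∀ s s' p, ρ (s + s') p = ρ s p + ρ s' p := by
  choose ρ hρ using fun s => exists_extension hk hc (g s)
  refine ⟨ρ, hρ, fun s s' p => ?_⟩
  have : ρ (s + s') = ρ s + ρ s' :=
    hom_ext_of_torsion hc fun n => by
      rw [LinearMap.add_apply, hρ, hρ, hρ, hg]
  rw [this, LinearMap.add_apply]

theorem left_torsion_of_mem_span {p q z : SymQuot Fl Fr R}
    (h : ((0 : Env R), z) ∈ Submodule.span (Env R) (prodGens p q)) : Fl.IsTorsionElem z := by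
  let φ : R →ₗ[R] SymQuot Fl Fr R :=
    { toFun := toSymQuot Fl Fr R, map_add' := map_add _, map_smul' := toSymQuot_smul }
  let g : SymQuot Fl Fr R → R →ₗ[R] ModQuot Fl (SymQuot Fl Fr R) := fun x =>
    toQuot Fl _ ∘ₗ LinearMap.toSpanSingleton R _ x
  obtain ⟨ρ, hρ, hadd⟩ := exists_biext Fl φ (fun n => exists_left_of_toSymQuot_eq_zero)
    exists_left_smul_mem g (fun s s' n => by simp [g])
  have hρ' : ∀ x r, ρ x (toSymQuot Fl Fr R r) = toQuot Fl _ (r • x) := hρ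
  have hρ'' : ∀ r x, ρ (toSymQuot Fl Fr R r) x = toQuot Fl _ (op r • x) := by
    intro r x
    let rm : SymQuot Fl Fr R →ₗ[R] SymQuot Fl Fr R :=
      { toFun := fun y => op r • y, map_add' := smul_add _,
        map_smul' := fun c y => (smul_comm c (op r) y).symm }
    have : ρ (toSymQuot Fl Fr R r) = toQuot Fl _ ∘ₗ rm := by
      refine hom_ext_of_torsion (φ := φ) exists_left_smul_mem fun n => ?_
      refine (hρ' _ _).trans ?_
      change _ = toQuot Fl _ (op r • toSymQuot Fl Fr R n)
      rw [← toSymQuot_mul, ← toSymQuot_mul']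
    rw [this]
    rfl
  let B : R →+ Rᵐᵒᵖ →+ ModQuot Fl (SymQuot Fl Fr R) :=
    AddMonoidHom.mk' (fun r => AddMonoidHom.mk' (fun s => ρ (s • q) (r • p))
      (fun s s' => by rw [add_smul, hadd])) (fun r r' => by ext s; simp [add_smul])
  let θ : Env R →+ ModQuot Fl (SymQuot Fl Fr R) := TensorProduct.liftAddHom B
    (fun c r s => by rw [map_zsmul, map_zsmul]; rfl)
  have hθ : ∀ r s, θ (r ⊗ₜ s) = ρ (s • q) (r • p) := fun r s => rfl
  have key : ∀ x ∈ Submodule.span (Env R) (prodGens p q), ∀ c : Env R,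
      θ (c * x.1) = toQuot Fl _ (c • x.2) := by
    intro x hx
    induction hx using Submodule.span_induction with
    | mem x hx =>
      intro c
      induction c using TensorProduct.induction_on with
      | zero =>
        have hz : (0 : Env R) • x.2 = 0 := zero_smul (Env R) x.2
        change θ ((0 : Env R) * x.1) = toQuot Fl _ ((0 : Env R) • x.2)
        rw [hz, zero_mul, map_zero, map_zero]
      | add c c' hc hc' => rw [add_mul, map_add, hc, hc', add_smul, map_add]
      | tmul r s =>
        rcases hx with ⟨a, r', h, rfl⟩ | ⟨b, r', h, rfl⟩
        · simp only [leftHom_apply, Algebra.TensorProduct.tmul_mul_tmul, mul_one, hθ, tmul_smul]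
          rw [mul_smul, h, ← toSymQuot_mul, hρ', mul_smul, smul_comm r' s q]
        · simp only [rightHom_apply, Algebra.TensorProduct.tmul_mul_tmul, mul_one, hθ, tmul_smul]
          rw [mul_smul, h]
          obtain ⟨s, rfl⟩ := op_surjective s
          rw [← toSymQuot_mul', hρ'', op_mul, mul_smul, smul_comm r (op s), smul_comm r (op r')]
    | zero => intro c; simp
    | add x y _ _ hx hy =>
      intro c
      rw [Prod.fst_add, Prod.snd_add, mul_add, map_add, hx, hy, smul_add, map_add]
    | smul t x _ hx =>
      intro c
      rw [Prod.smul_fst, Prod.smul_snd, smul_eq_mul, ← mul_assoc, hx, mul_smul]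
  have := key _ h 1
  rw [mul_zero, map_zero, one_smul] at this
  exact toQuot_eq_zero.mp this.symm

theorem right_torsion_of_mem_span {p q z : SymQuot Fl Fr R}
    (h : ((0 : Env R), z) ∈ Submodule.span (Env R) (prodGens p q)) : Fr.IsTorsionElem z := by
  let φ : R →ₗ[Rᵐᵒᵖ] SymQuot Fl Fr R :=
    { toFun := toSymQuot Fl Fr R, map_add' := map_add _, map_smul' := toSymQuot_op_smul }
  let g : SymQuot Fl Fr R → R →ₗ[Rᵐᵒᵖ] ModQuot Fr (SymQuot Fl Fr R) := fun x =>
    toQuot Fr _ ∘ₗ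
      { toFun := fun r => op r • x
        map_add' := fun r r' => by rw [op_add, add_smul]
        map_smul' := fun c r => by rw [RingHom.id_apply, smul_smul]; rfl }
  obtain ⟨ρ, hρ, hadd⟩ := exists_biext Fr φ (fun n => exists_right_of_toSymQuot_eq_zero)
    exists_right_smul_mem g (fun s s' n => by simp [g])
  have hρ' : ∀ x r, ρ x (toSymQuot Fl Fr R r) = toQuot Fr _ (op r • x) := hρ
  have hρ'' : ∀ r x, ρ (toSymQuot Fl Fr R r) x = toQuot Fr _ (r • x) := by
    intro r x
    let rm : SymQuot Fl Fr R →ₗ[Rᵐᵒᵖ] SymQuot Fl Fr R :=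
      { toFun := fun y => r • y, map_add' := smul_add _,
        map_smul' := fun c y => smul_comm r c y }
    have : ρ (toSymQuot Fl Fr R r) = toQuot Fr _ ∘ₗ rm := by
      refine hom_ext_of_torsion (φ := φ) exists_right_smul_mem fun n => ?_
      refine (hρ' _ _).trans ?_
      change _ = toQuot Fr _ (r • toSymQuot Fl Fr R n)
      rw [← toSymQuot_mul, ← toSymQuot_mul']
    rw [this]
    rfl
  let B : R →+ Rᵐᵒᵖ →+ ModQuot Fr (SymQuot Fl Fr R) :=
    AddMonoidHom.mk' (fun r => AddMonoidHom.mk' (fun s => ρ (r • p) (s • q))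
      (fun s s' => by rw [add_smul, map_add])) (fun r r' => by ext s; simp [add_smul, hadd])
  let θ : Env R →+ ModQuot Fr (SymQuot Fl Fr R) := TensorProduct.liftAddHom B
    (fun c r s => by rw [map_zsmul, map_zsmul]; rfl)
  have hθ : ∀ r s, θ (r ⊗ₜ s) = ρ (r • p) (s • q) := fun r s => rfl
  have key : ∀ x ∈ Submodule.span (Env R) (prodGens p q), ∀ c : Env R,
      θ (c * x.1) = toQuot Fr _ (c • x.2) := by
    intro x hx
    induction hx using Submodule.span_induction with
    | mem x hx =>
      intro c
      induction c using TensorProduct.induction_on with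
      | zero =>
        have hz : (0 : Env R) • x.2 = 0 := zero_smul (Env R) x.2
        change θ ((0 : Env R) * x.1) = toQuot Fr _ ((0 : Env R) • x.2)
        rw [hz, zero_mul, map_zero, map_zero]
      | add c c' hc hc' => rw [add_mul, map_add, hc, hc', add_smul, map_add]
      | tmul r s =>
        rcases hx with ⟨a, r', h, rfl⟩ | ⟨b, r', h, rfl⟩
        · simp only [leftHom_apply, Algebra.TensorProduct.tmul_mul_tmul, mul_one, hθ, tmul_smul]
          rw [mul_smul, h, ← toSymQuot_mul, hρ'', mul_smul, smul_comm r' s q]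
        · simp only [rightHom_apply, Algebra.TensorProduct.tmul_mul_tmul, mul_one, hθ, tmul_smul]
          rw [mul_smul, h]
          obtain ⟨s, rfl⟩ := op_surjective s
          rw [← toSymQuot_mul', hρ', op_mul, mul_smul, smul_comm r (op s), smul_comm r (op r')]
    | zero => intro c; simp
    | add x y _ _ hx hy =>
      intro c
      rw [Prod.fst_add, Prod.snd_add, mul_add, map_add, hx, hy, smul_add, map_add]
    | smul t x _ hx =>
      intro c
      rw [Prod.smul_fst, Prod.smul_snd, smul_eq_mul, ← mul_assoc, hx, mul_smul]
  have := key _ h 1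
  rw [mul_zero, map_zero, one_smul] at this
  exact toQuot_eq_zero.mp this.symm

theorem exists_isProduct (p q : SymQuot Fl Fr R) : ∃ s, IsProduct p q s := by
  let G := Submodule.span (Env R) (prodGens p q)
  have uniq : ∀ t z z', (t, z) ∈ G → (t, z') ∈ G → z = z' := by
    intro t z z' h h'
    have : ((0 : Env R), z - z') ∈ G := by simpa using G.sub_mem h h'
    exact sub_eq_zero.mp
      (sym_eq_zero (left_torsion_of_mem_span this) (right_torsion_of_mem_span this))
  let K : Ideal (Env R) := G.map (LinearMap.fst (Env R) (Env R) (SymQuot Fl Fr R))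
  have hK' : ∀ t : K, ∃ z, (t.1, z) ∈ G := by
    rintro ⟨t, ⟨t', z⟩, h, rfl⟩
    exact ⟨z, h⟩
  have mem_l : ∀ a r : R, a • p = toSymQuot Fl Fr R r → (leftHom a, r • q) ∈ G :=
    fun a r h => Submodule.subset_span (Or.inl ⟨a, r, h, rfl⟩)
  have mem_r : ∀ b r : R, op b • q = toSymQuot Fl Fr R r → (rightHom (op b), op r • p) ∈ G :=
    fun b r h => Submodule.subset_span (Or.inr ⟨b, r, h, rfl⟩)
  have hK : K ∈ symmetricFilter Fl Fr := by
    obtain ⟨I, hI, e⟩ := exists_left_smul_mem p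
    obtain ⟨J, hJ, e'⟩ := exists_right_smul_mem q
    rw [mem_symmetricFilter_iff]
    refine ⟨Order.PFilter.mem_of_le (fun a ha => ?_) hI,
      Order.PFilter.mem_of_le (fun b hb => ?_) hJ⟩
    · obtain ⟨r, hr⟩ := e a ha
      exact ⟨_, mem_l a r hr, rfl⟩
    · obtain ⟨r, hr⟩ := e' b hb
      exact ⟨_, mem_r b.unop r hr, rfl⟩
  choose f hf using hK'
  let h : K →ₗ[Env R] SymQuot Fl Fr R :=
    { toFun := f
      map_add' := fun x y => uniq _ _ _ (hf (x + y)) (G.add_mem (hf x) (hf y))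
      map_smul' := fun c x => uniq _ _ _ (hf (c • x)) (G.smul_mem c (hf x)) }
  let _ : Module (Env R) R := TensorProduct.Algebra.module
  obtain ⟨s, hs⟩ := exists_eq_smul (F := symmetricFilter Fl Fr) (M := R) hK h
  have hs' : ∀ t z, (t, z) ∈ G → t • s = z := fun t z htz =>
    (hs t ⟨_, htz, rfl⟩).trans (uniq _ _ _ (hf ⟨t, _, htz, rfl⟩) htz)
  exact ⟨s, fun a r e => hs' _ _ (mem_l a r e), fun b r e => hs' _ _ (mem_r b r e)⟩

instance : Mul (SymQuot Fl Fr R) := ⟨fun p q => (exists_isProduct p q).choose⟩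

instance : One (SymQuot Fl Fr R) := ⟨toSymQuot Fl Fr R 1⟩

theorem sym_one_def : (1 : SymQuot Fl Fr R) = toSymQuot Fl Fr R 1 := rfl

theorem mul_isProduct (p q : SymQuot Fl Fr R) : IsProduct p q (p * q) :=
  (exists_isProduct p q).choose_spec

theorem eq_mul_of_isProduct {p q s : SymQuot Fl Fr R} (h : IsProduct p q s) : s = p * q := by
  obtain ⟨I, hI, e⟩ := exists_left_smul_mem p
  obtain ⟨J, hJ, e'⟩ := exists_right_smul_mem q
  refine sym_ext hI hJ (fun a ha => ?_) fun b hb => ?_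
  · obtain ⟨r, hr⟩ := e a ha
    rw [h.1 a r hr, (mul_isProduct p q).1 a r hr]
  · obtain ⟨r, hr⟩ := e' b hb
    rw [← op_unop b] at hr ⊢
    rw [h.2 _ r hr, (mul_isProduct p q).2 _ r hr]

theorem toSymQuot_mul_eq (r : R) (q : SymQuot Fl Fr R) : toSymQuot Fl Fr R r * q = r • q := by
  simpa using (mul_isProduct (toSymQuot Fl Fr R r) q).1 1 r (one_smul _ _)

theorem mul_toSymQuot_eq (r : R) (p : SymQuot Fl Fr R) : p * toSymQuot Fl Fr R r = op r • p := by
  simpa using (mul_isProduct p (toSymQuot Fl Fr R r)).2 1 r (by simp)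

theorem smul_mul_eq (r : R) (p q : SymQuot Fl Fr R) : (r • p) * q = r • (p * q) := by
  obtain ⟨I, hI, e⟩ := exists_left_smul_mem p
  obtain ⟨J, hJ, e'⟩ := exists_right_smul_mem q
  refine sym_ext (IdealFilter.IsUniform.colon_mem hI r) hJ (fun a ha => ?_) fun b hb => ?_
  · obtain ⟨r', hr⟩ := e _ (Submodule.mem_colon_singleton.mp ha)
    rw [smul_smul, (mul_isProduct p q).1 (a * r) r' hr,
      (mul_isProduct (r • p) q).1 a r' (by rw [smul_smul]; exact hr)]
  · obtain ⟨r', hr⟩ := e' b hb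
    rw [← op_unop b] at hr ⊢
    rw [← smul_comm r (op b.unop) (p * q), (mul_isProduct p q).2 _ r' hr,
      (mul_isProduct (r • p) q).2 _ r' hr, smul_comm r (op r') p]

theorem mul_op_smul_eq (s : Rᵐᵒᵖ) (p q : SymQuot Fl Fr R) : p * (s • q) = s • (p * q) := by
  obtain ⟨I, hI, e⟩ := exists_left_smul_mem p
  obtain ⟨J, hJ, e'⟩ := exists_right_smul_mem q
  refine sym_ext hI (IdealFilter.IsUniform.colon_mem hJ s) (fun a ha => ?_) fun b hb => ?_
  · obtain ⟨r', hr⟩ := e a ha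
    rw [smul_comm a s, (mul_isProduct p q).1 a r' hr,
      (mul_isProduct p (s • q)).1 a r' hr, smul_comm]
  · obtain ⟨r', hr⟩ := e' _ (Submodule.mem_colon_singleton.mp hb)
    obtain ⟨b, rfl⟩ := op_surjective b
    obtain ⟨s, rfl⟩ := op_surjective s
    rw [smul_eq_mul, ← op_mul] at hr
    rw [smul_smul, ← op_mul, (mul_isProduct p q).2 _ r' hr,
      (mul_isProduct p (op s • q)).2 b r' (by rw [smul_smul, ← op_mul]; exact hr)]

/-- The symmetric ring of quotients. -/
instance : Ring (SymQuot Fl Fr R) :=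
  { (inferInstance : AddCommGroup (SymQuot Fl Fr R)), (inferInstance : Mul (SymQuot Fl Fr R)),
    (inferInstance : One (SymQuot Fl Fr R)) with
    one_mul := fun q => by rw [sym_one_def, toSymQuot_mul_eq, one_smul]
    mul_one := fun q => by rw [sym_one_def, mul_toSymQuot_eq, op_one, one_smul]
    zero_mul := fun q => by
      rw [← map_zero (toSymQuot Fl Fr R), toSymQuot_mul_eq, zero_smul, map_zero]
    mul_zero := fun q => by
      rw [← map_zero (toSymQuot Fl Fr R), mul_toSymQuot_eq, op_zero, zero_smul, map_zero]
    left_distrib := fun p q q' => by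
      obtain ⟨I, hI, e⟩ := exists_left_smul_mem p
      obtain ⟨J, hJ, f⟩ := exists_right_smul_mem q
      obtain ⟨J', hJ', f'⟩ := exists_right_smul_mem q'
      refine sym_ext hI (Fr.inf_mem hJ hJ') (fun a ha => ?_) fun b hb => ?_
      · obtain ⟨r, hr⟩ := e a ha
        rw [smul_add, (mul_isProduct _ _).1 a r hr, (mul_isProduct _ _).1 a r hr,
          (mul_isProduct _ _).1 a r hr, smul_add]
      · obtain ⟨r, hr⟩ := f b hb.1
        obtain ⟨r', hr'⟩ := f' b hb.2
        obtain ⟨b, rfl⟩ := op_surjective b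
        rw [smul_add, (mul_isProduct _ _).2 b r hr, (mul_isProduct _ _).2 b r' hr',
          (mul_isProduct _ _).2 b (r + r') (by rw [smul_add, hr, hr', map_add]), op_add, add_smul]
    right_distrib := fun p p' q => by
      obtain ⟨I, hI, e⟩ := exists_left_smul_mem p
      obtain ⟨I', hI', e'⟩ := exists_left_smul_mem p'
      obtain ⟨J, hJ, f⟩ := exists_right_smul_mem q
      refine sym_ext (Fl.inf_mem hI hI') hJ (fun a ha => ?_) fun b hb => ?_
      · obtain ⟨r, hr⟩ := e a ha.1
        obtain ⟨r', hr'⟩ := e' a ha.2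
        rw [smul_add, (mul_isProduct _ _).1 a r hr, (mul_isProduct _ _).1 a r' hr',
          (mul_isProduct _ _).1 a (r + r') (by rw [smul_add, hr, hr', map_add]), add_smul]
      · obtain ⟨r, hr⟩ := f b hb
        obtain ⟨b, rfl⟩ := op_surjective b
        rw [smul_add, (mul_isProduct _ _).2 b r hr, (mul_isProduct _ _).2 b r hr,
          (mul_isProduct _ _).2 b r hr, smul_add]
    mul_assoc := fun p q w => by
      obtain ⟨I, hI, e⟩ := exists_left_smul_mem p
      obtain ⟨J, hJ, f⟩ := exists_right_smul_mem w
      refine sym_ext hI hJ (fun a ha => ?_) fun b hb => ?_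
      · obtain ⟨r, hr⟩ := e a ha
        rw [← smul_mul_eq, (mul_isProduct p q).1 a r hr, smul_mul_eq,
          (mul_isProduct p (q * w)).1 a r hr]
      · obtain ⟨r, hr⟩ := f b hb
        obtain ⟨b, rfl⟩ := op_surjective b
        rw [(mul_isProduct (p * q) w).2 b r hr, ← mul_op_smul_eq (op b) p,
          (mul_isProduct q w).2 b r hr, mul_op_smul_eq] }

end Ring

/-! ### Derivations -/

section Derivations

/-- A derivation of a (not necessarily commutative) ring. -/
def IsRingDerivation {S : Type*} [Ring S] (δ : S →+ S) : Prop :=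
  ∀ r s, δ (r * s) = δ r * s + r * δ s

/-- A `δ`-derivation of an `R`-bimodule: `d (x r) = d x r + x δ r` and `d (r x) = δ r x + r d x`. -/
def IsBimoduleDerivation {M : Type*} [AddCommGroup M] [Module R M] [Module Rᵐᵒᵖ M]
    (δ : R →+ R) (d : M →+ M) : Prop :=
  (∀ (x : M) (r : R), d (op r • x) = op r • d x + op (δ r) • x) ∧
    ∀ (r : R) (x : M), d (r • x) = δ r • x + r • d x

/-- The map on the enveloping ring induced by `δ`: `r ⊗ s ↦ δ r ⊗ s + r ⊗ δ s`. -/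
def envDerivation (δ : R →+ R) : Env R →+ Env R :=
  (TensorProduct.map δ.toIntLinearMap LinearMap.id +
    TensorProduct.map LinearMap.id (AddMonoidHom.mulOp δ).toIntLinearMap :
      Env R →ₗ[ℤ] Env R).toAddMonoidHom

theorem envDerivation_tmul (δ : R →+ R) (r s : R) :
    envDerivation δ (r ⊗ₜ[ℤ] op s) = δ r ⊗ₜ[ℤ] op s + r ⊗ₜ[ℤ] op (δ s) := rfl

/-- The symmetric filter is differential: for every derivation `δ` of `R`, every member `I` of the
filter contains the image under the derivation of `R ⊗ Rᵒᵖ` induced by `δ` of some member `J`. -/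
def SymDifferential (Fl : IdealFilter R) (Fr : IdealFilter Rᵐᵒᵖ) : Prop :=
  ∀ δ : R →+ R, IsRingDerivation δ → ∀ I ∈ symmetricFilter Fl Fr, ∃ J ∈ symmetricFilter Fl Fr,
    ∀ t ∈ J, envDerivation δ t ∈ I

/-- The symmetric filter is faithful: the bimodule `R` is torsion-free. -/
def SymFaithful (Fl : IdealFilter R) (Fr : IdealFilter Rᵐᵒᵖ) [Fl.IsGabriel] [Fr.IsGabriel] : Prop :=
  SymTorsionFree Fl Fr R

/-- The maps `d₁` and `d₂` on the symmetric modules of quotients extend `d`, and they agree: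
`d₁ q₁ = q₁ d`, `d₂ q₂ = q₂ d` and `d₂ q₁₂ = q₁₂ d₁`. -/
structure ExtensionsAgree {M : Type*} [AddCommGroup M] [Module R M] [Module Rᵐᵒᵖ M]
    [SMulCommClass R Rᵐᵒᵖ M] {Fl₁ Fl₂ : IdealFilter R} {Fr₁ Fr₂ : IdealFilter Rᵐᵒᵖ}
    [Fl₁.IsGabriel] [Fl₂.IsGabriel] [Fr₁.IsGabriel] [Fr₂.IsGabriel]
    (h : symmetricFilter Fl₁ Fr₁ ≤ symmetricFilter Fl₂ Fr₂) (d : M →+ M)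
    (d₁ : SymQuot Fl₁ Fr₁ M →+ SymQuot Fl₁ Fr₁ M)
    (d₂ : SymQuot Fl₂ Fr₂ M →+ SymQuot Fl₂ Fr₂ M) : Prop where
  extends_first : ∀ m, d₁ (toSymQuot Fl₁ Fr₁ M m) = toSymQuot Fl₁ Fr₁ M (d m)
  extends_second : ∀ m, d₂ (toSymQuot Fl₂ Fr₂ M m) = toSymQuot Fl₂ Fr₂ M (d m)
  agree : ∀ z, d₂ (symTransition M h z) = symTransition M h (d₁ z)

end Derivations

end Bimodule

end TorsionQuotient
end

open TorsionQuotient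

/-!
A derivation `∂` along a linear map `f : N → C` is the same thing as a linear map `n ↦ f n + ε ∂ n`
into the module `C[ε]` of dual numbers, on which `a` acts through `a + ε D a`. If `C` is closed for
a Gabriel filter then so is `C[ε]`. Hence derivations extend along every map with torsion kernel and
cokernel, in particular to modules of quotients. The extension is unique because `C` is
torsion-free, so the extensions for two comparable filters agree. On the symmetric ring of
quotients, the defect `d (p q) - (d p q + p d q)` is left linear in `p` and right linear in `q` and
vanishes if `p` or `q` is `1`; being killed by a left and a right ideal of the filters, it is zero.
-/

namespace TorsionQuotient

/-! ## Derivations along linear maps -/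

section Derivation

variable {A : Type*} [Ring A] {D : A →+ A}

theorem IsRingDerivation.map_one_eq_zero (hD : IsRingDerivation D) : D 1 = 0 := by
  simpa using hD 1 1

variable {N P C : Type*} [AddCommGroup N] [Module A N] [AddCommGroup P] [Module A P]
  [AddCommGroup C] [Module A C]

/-- A `D`-derivation along a linear map `f : N → C`, for a derivation `D` of the ring of scalars.
For `f = id` this is a `D`-derivation of the module `N`. -/
def IsDerivationAlong (D : A →+ A) (f : N →ₗ[A] C) (d : N →+ C) : Prop :=
  ∀ (a : A) (x : N), d (a • x) = D a • f x + a • d x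

theorem IsDerivationAlong.precomp {f : P →ₗ[A] C} {d : P →+ C} (hd : IsDerivationAlong D f d)
    (φ : N →ₗ[A] P) : IsDerivationAlong D (f ∘ₗ φ) (d.comp φ.toAddMonoidHom) := fun a x =>
  (congrArg d (map_smul φ a x)).trans (hd a (φ x))

theorem IsDerivationAlong.postcomp {f : N →ₗ[A] P} {d : N →+ P} (hd : IsDerivationAlong D f d)
    (g : P →ₗ[A] C) : IsDerivationAlong D (g ∘ₗ f) (g.toAddMonoidHom.comp d) := fun a x => by
  simp [hd a x]

/-- Two derivations along the same linear map differ by a linear map. -/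
def IsDerivationAlong.subLinear {f : N →ₗ[A] C} {d d' : N →+ C} (hd : IsDerivationAlong D f d)
    (hd' : IsDerivationAlong D f d') : N →ₗ[A] C where
  __ := d - d'
  map_smul' a x := by
    change d (a • x) - d' (a • x) = a • (d x - d' x)
    rw [hd, hd', add_sub_add_left_eq_sub, smul_sub]

/-- The module `N[ε]` of dual numbers over `N`, twisted by a derivation `D` of the ring of scalars:
the pair `(x, y)` stands for `x + ε y`, and `a` acts as `a + ε D a`. Linear maps into `N[ε]` encode
`D`-derivations. -/
def TwistedDual (_ : IsRingDerivation D) (N : Type*) : Type _ := N × N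

namespace TwistedDual

variable (hD : IsRingDerivation D)

instance : AddCommGroup (TwistedDual hD N) := inferInstanceAs (AddCommGroup (N × N))

instance : Module A (TwistedDual hD N) where
  smul a x := (a • x.1, D a • x.1 + a • x.2)
  one_smul x := Prod.ext (one_smul A x.1) <| by
    change D 1 • x.1 + (1 : A) • x.2 = x.2
    rw [hD.map_one_eq_zero, zero_smul, one_smul, zero_add]
  mul_smul a b x := Prod.ext (mul_smul a b x.1) <| by
    change D (a * b) • x.1 + (a * b) • x.2 = D a • b • x.1 + a • (D b • x.1 + b • x.2)
    rw [hD, add_smul, smul_add, mul_smul, mul_smul, mul_smul, add_assoc]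
  smul_zero a := Prod.ext (smul_zero a) <| by
    change D a • (0 : N) + a • (0 : N) = 0
    rw [smul_zero, smul_zero, add_zero]
  smul_add a x y := Prod.ext (smul_add a x.1 y.1) <| by
    change D a • (x.1 + y.1) + a • (x.2 + y.2) = D a • x.1 + a • x.2 + (D a • y.1 + a • y.2)
    rw [smul_add, smul_add, add_add_add_comm]
  add_smul a b x := Prod.ext (add_smul a b x.1) <| by
    change D (a + b) • x.1 + (a + b) • x.2 = D a • x.1 + a • x.2 + (D b • x.1 + b • x.2)
    rw [map_add, add_smul, add_smul, add_add_add_comm]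
  zero_smul x := Prod.ext (zero_smul A x.1) <| by
    change D 0 • x.1 + (0 : A) • x.2 = 0
    rw [map_zero, zero_smul, zero_smul, add_zero]

/-- The linear projection `x + ε y ↦ x`. -/
def fst : TwistedDual hD N →ₗ[A] N where
  toFun x := x.1
  map_add' _ _ := rfl
  map_smul' _ _ := rfl

/-- The additive projection `x + ε y ↦ y`, the universal `D`-derivation into `N`. -/
def snd : TwistedDual hD N →+ N := AddMonoidHom.snd N N

theorem isDerivationAlong_snd : IsDerivationAlong D (fst hD) (snd hD : _ →+ N) := fun _ _ => rfl

/-- The linear map `x ↦ f x + ε d x` encoding a derivation `d` along `f`. -/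
def ofDerivation {f : N →ₗ[A] C} {d : N →+ C} (hd : IsDerivationAlong D f d) :
    N →ₗ[A] TwistedDual hD C where
  toFun x := (f x, d x)
  map_add' x y := Prod.ext (map_add f x y) (map_add d x y)
  map_smul' a x := Prod.ext (map_smul f a x) (hd a x)

end TwistedDual

end Derivation

/-! ## Closed modules -/

section Closed

variable {A : Type*} [Ring A] {F : IdealFilter A} [F.IsGabriel]
  {N P C : Type*} [AddCommGroup N] [Module A N] [AddCommGroup P] [Module A P]
  [AddCommGroup C] [Module A C]

theorem isTorsionFree_iff : IsTorsionFree F N ↔ ∀ x : N, F.IsTorsionElem x → x = 0 :=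
  Submodule.eq_bot_iff _

variable (F C) in
/-- A module is closed for a Gabriel filter if every homomorphism to it from a member of the filter
is the multiplication by a unique element. Uniqueness is stated as torsion-freeness. -/
structure IsClosedModule : Prop where
  isTorsionFree : IsTorsionFree F C
  exists_eq_smul : ∀ {K : Ideal A}, K ∈ F → ∀ f : K →ₗ[A] C, ∃ x : C, ∀ a : K, a.1 • x = f a

theorem isClosedModule_modQuot : IsClosedModule F (ModQuot F N) where
  isTorsionFree := isTorsionFree_iff.mpr fun _ ⟨_, hL, hx⟩ => eq_zero_of_smul hL hx
  exists_eq_smul hK f := (exists_eq_smul hK f).imp fun _ hx a => hx a.1 a.2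

theorem IsTorsionFree.toQuot_injective (hC : IsTorsionFree F C) :
    Function.Injective (toQuot F C) :=
  (injective_iff_map_eq_zero _).mpr fun _ hx => isTorsionFree_iff.mp hC _ (toQuot_eq_zero.mp hx)

theorem IsClosedModule.toQuot_surjective (hC : IsClosedModule F C) :
    Function.Surjective (toQuot F C) := by
  intro z
  obtain ⟨K, hK, hz⟩ := exists_smul_mem_range z
  let e := LinearEquiv.ofInjective (toQuot F C) hC.isTorsionFree.toQuot_injective
  let f : K →ₗ[A] C := e.symm.toLinearMap ∘ₗ
    (LinearMap.toSpanSingleton A _ z ∘ₗ K.subtype).codRestrict (LinearMap.range (toQuot F C))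
      fun a => (hz a.1 a.2).imp fun _ => Eq.symm
  have toQuot_f (a : K) : toQuot F C (f a) = a.1 • z :=
    congrArg Subtype.val (e.apply_symm_apply _)
  obtain ⟨x, hx⟩ := hC.exists_eq_smul hK f
  exact ⟨x, eq_of_smul hK fun a ha => by rw [← map_smul, hx ⟨a, ha⟩, toQuot_f]⟩

theorem IsClosedModule.exists_extension (hC : IsClosedModule F C) {φ : N →ₗ[A] P}
    (hker : ∀ n, φ n = 0 → F.IsTorsionElem n)
    (hcoker : ∀ p : P, ∃ K ∈ F, ∀ a ∈ K, ∃ n, a • p = φ n) (g : N →ₗ[A] C) :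
    ∃ g' : P →ₗ[A] C, g' ∘ₗ φ = g := by
  let e := LinearEquiv.ofBijective (toQuot F C)
    ⟨hC.isTorsionFree.toQuot_injective, hC.toQuot_surjective⟩
  obtain ⟨g', hg'⟩ := TorsionQuotient.exists_extension hker hcoker (toQuot F C ∘ₗ g)
  refine ⟨e.symm.toLinearMap ∘ₗ g', LinearMap.ext fun n => ?_⟩
  exact (e.symm_apply_eq).mpr (hg' n)

theorem IsTorsionFree.eq_of_smul (hC : IsTorsionFree F C) {K : Ideal A} (hK : K ∈ F) {x y : C}
    (h : ∀ a ∈ K, a • x = a • y) : x = y :=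
  sub_eq_zero.mp <| isTorsionFree_iff.mp hC _
    ⟨K, hK, fun a ha => by rw [smul_sub, h a ha, sub_self]⟩

theorem IsTorsionFree.hom_ext (hC : IsTorsionFree F C) {φ : N →ₗ[A] P}
    (hcoker : ∀ p : P, ∃ K ∈ F, ∀ a ∈ K, ∃ n, a • p = φ n) {g g' : P →ₗ[A] C}
    (h : g ∘ₗ φ = g' ∘ₗ φ) : g = g' := by
  ext p
  obtain ⟨K, hK, hp⟩ := hcoker p
  refine hC.eq_of_smul hK fun a ha => ?_
  obtain ⟨n, hn⟩ := hp a ha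
  rw [← map_smul, ← map_smul, hn]
  exact LinearMap.congr_fun h n

variable {D : A →+ A}

theorem IsTorsionFree.twistedDual (hD : IsRingDerivation D) (hC : IsTorsionFree F C) :
    IsTorsionFree F (TwistedDual hD C) := by
  refine isTorsionFree_iff.mpr fun x ⟨K, hK, hx⟩ => ?_
  have eq_zero {y : C} (hy : ∀ a ∈ K, a • y = 0) : y = 0 :=
    isTorsionFree_iff.mp hC y ⟨K, hK, hy⟩
  have fst_eq_zero : x.1 = 0 := eq_zero fun a ha => congrArg Prod.fst (hx a ha)
  refine Prod.ext fst_eq_zero (eq_zero fun a ha => ?_)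
  have snd_smul : D a • x.1 + a • x.2 = 0 := congrArg Prod.snd (hx a ha)
  rwa [fst_eq_zero, smul_zero, zero_add] at snd_smul

/-- The element `x + ε y` by which a homomorphism `f` to `C[ε]` is the multiplication is found one
component at a time: first `x`, and then `y` from the difference of the derivations `snd ∘ f` and
`a ↦ D a • x`, both along `a ↦ a • x`. -/
theorem IsClosedModule.twistedDual (hD : IsRingDerivation D) (hC : IsClosedModule F C) :
    IsClosedModule F (TwistedDual hD C) where
  isTorsionFree := hC.isTorsionFree.twistedDual hD
  exists_eq_smul {K} hK f := by
    obtain ⟨x, hx⟩ := hC.exists_eq_smul hK (TwistedDual.fst hD ∘ₗ f)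
    let d : K →+ C :=
      ((LinearMap.toSpanSingleton A C x).toAddMonoidHom.comp D).comp K.subtype.toAddMonoidHom
    have hd : IsDerivationAlong D (TwistedDual.fst hD ∘ₗ f) d := fun a b => by
      change D (a * b.1) • x = D a • (f b).1 + a • D b.1 • x
      have fst_f : b.1 • x = (f b).1 := hx b
      rw [hD, add_smul, mul_smul, mul_smul, fst_f]
    obtain ⟨y, hy⟩ := hC.exists_eq_smul hK
      (((TwistedDual.isDerivationAlong_snd hD).precomp f).subLinear hd)
    refine ⟨(x, y), fun a => Prod.ext (hx a) ?_⟩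
    change D a.1 • x + a.1 • y = (f a).2
    rw [hy a]
    exact add_sub_cancel (D a.1 • x) (f a).2

theorem IsDerivationAlong.exists_extension (hD : IsRingDerivation D) (hC : IsClosedModule F C)
    {φ : N →ₗ[A] P} (hker : ∀ n, φ n = 0 → F.IsTorsionElem n)
    (hcoker : ∀ p : P, ∃ K ∈ F, ∀ a ∈ K, ∃ n, a • p = φ n) {f : P →ₗ[A] C} {d : N →+ C}
    (hd : IsDerivationAlong D (f ∘ₗ φ) d) :
    ∃ d' : P →+ C, IsDerivationAlong D f d' ∧ ∀ n, d' (φ n) = d n := by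
  obtain ⟨g, hg⟩ := (hC.twistedDual hD).exists_extension hker hcoker
    (TwistedDual.ofDerivation hD hd)
  have fst_comp_g : TwistedDual.fst hD ∘ₗ g = f :=
    hC.isTorsionFree.hom_ext hcoker (congrArg (TwistedDual.fst hD ∘ₗ ·) hg)
  refine ⟨(TwistedDual.snd hD).comp g.toAddMonoidHom, ?_, fun n => ?_⟩
  · exact fst_comp_g ▸ (TwistedDual.isDerivationAlong_snd hD).precomp g
  · exact congrArg Prod.snd (LinearMap.congr_fun hg n)

theorem IsDerivationAlong.ext_of_torsion (hC : IsTorsionFree F C) {φ : N →ₗ[A] P}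
    (hcoker : ∀ p : P, ∃ K ∈ F, ∀ a ∈ K, ∃ n, a • p = φ n) {f : P →ₗ[A] C} {d d' : P →+ C}
    (hd : IsDerivationAlong D f d) (hd' : IsDerivationAlong D f d')
    (h : ∀ n, d (φ n) = d' (φ n)) : d = d' := by
  have subLinear_eq_zero : hd.subLinear hd' = 0 :=
    hC.hom_ext hcoker (LinearMap.ext fun n => sub_eq_zero.mpr (h n))
  exact AddMonoidHom.ext fun p => sub_eq_zero.mp (LinearMap.congr_fun subLinear_eq_zero p)

theorem exists_modQuot_derivation (hD : IsRingDerivation D) {d : N →+ N}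
    (hd : IsDerivationAlong D LinearMap.id d) :
    ∃ d' : ModQuot F N →+ ModQuot F N, IsDerivationAlong D LinearMap.id d' ∧
      ∀ x, d' (toQuot F N x) = toQuot F N (d x) :=
  IsDerivationAlong.exists_extension (f := LinearMap.id) hD isClosedModule_modQuot
    (fun _ => toQuot_eq_zero.mp) exists_smul_mem_range (hd.postcomp (toQuot F N))

variable {G : IdealFilter A} [G.IsGabriel] (h : F ≤ G)

variable (N) in
/-- The natural map `N_F → N_G` as a linear map. -/
noncomputable def transitionLinear : ModQuot F N →ₗ[A] ModQuot G N where
  __ := transitionHom N h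
  map_smul' := transitionHom_smul N h

theorem modQuot_derivations_agree {d : N →+ N} {d₁ : ModQuot F N →+ ModQuot F N}
    {d₂ : ModQuot G N →+ ModQuot G N} (hd₁ : IsDerivationAlong D LinearMap.id d₁)
    (hd₂ : IsDerivationAlong D LinearMap.id d₂) (h₁ : ∀ x, d₁ (toQuot F N x) = toQuot F N (d x))
    (h₂ : ∀ x, d₂ (toQuot G N x) = toQuot G N (d x)) (z : ModQuot F N) :
    d₂ (transitionHom N h z) = transitionHom N h (d₁ z) := by
  have cokernel_torsion (z : ModQuot F N) : ∃ K ∈ G, ∀ a ∈ K, ∃ x, a • z = toQuot F N x :=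
    (exists_smul_mem_range z).imp fun _ hK => hK.imp_left (h ·)
  refine DFunLike.congr_fun (IsDerivationAlong.ext_of_torsion
    isClosedModule_modQuot.isTorsionFree cokernel_torsion
    (hd₂.precomp (transitionLinear N h)) (hd₁.postcomp (transitionLinear N h)) fun x => ?_) z
  change d₂ (transitionHom N h (toQuot F N x)) = transitionHom N h (d₁ (toQuot F N x))
  rw [transitionHom_toQuot, h₁, h₂, transitionHom_toQuot]

end Closed

/-! ## Bimodules -/

section Bimodule

open MulOpposite

variable {R : Type*} [Ring R] {δ : R →+ R}

theorem envDerivation_leftHom (hδ : IsRingDerivation δ) (r : R) :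
    envDerivation δ (leftHom r) = leftHom (δ r) := by
  rw [leftHom_apply, leftHom_apply, ← op_one, envDerivation_tmul, hδ.map_one_eq_zero, op_zero,
    TensorProduct.tmul_zero, add_zero]

theorem envDerivation_rightHom (hδ : IsRingDerivation δ) (s : R) :
    envDerivation δ (rightHom (op s)) = rightHom (op (δ s)) := by
  rw [rightHom_apply, rightHom_apply, envDerivation_tmul, hδ.map_one_eq_zero,
    TensorProduct.zero_tmul, zero_add]

theorem IsRingDerivation.envDerivation (hδ : IsRingDerivation δ) :
    IsRingDerivation (envDerivation δ) := by
  intro x y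
  induction x using TensorProduct.induction_on with
  | zero => simp
  | add x x' hx hx' => rw [add_mul, map_add, hx, hx', map_add, add_mul, add_mul]; abel
  | tmul r s =>
    induction y using TensorProduct.induction_on with
    | zero => simp
    | add y y' hy hy' => rw [mul_add, map_add, hy, hy', map_add, mul_add, mul_add]; abel
    | tmul r' s' =>
      obtain ⟨s, rfl⟩ := op_surjective s
      obtain ⟨s', rfl⟩ := op_surjective s'
      rw [Algebra.TensorProduct.tmul_mul_tmul, ← op_mul, envDerivation_tmul, envDerivation_tmul,
        envDerivation_tmul, hδ, hδ, op_add, add_mul, mul_add]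
      simp only [Algebra.TensorProduct.tmul_mul_tmul, TensorProduct.add_tmul,
        TensorProduct.tmul_add, op_mul]
      abel

theorem isBimoduleDerivation_iff {M : Type*} [AddCommGroup M] [Module R M] [Module Rᵐᵒᵖ M]
    [Module (Env R) M] (hl : ∀ (r : R) (x : M), leftHom r • x = r • x)
    (hr : ∀ (s : Rᵐᵒᵖ) (x : M), rightHom s • x = s • x) (hδ : IsRingDerivation δ) {d : M →+ M} :
    IsBimoduleDerivation δ d ↔ IsDerivationAlong (envDerivation δ) LinearMap.id d := by
  constructor
  · intro hd t x
    induction t using TensorProduct.induction_on with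
    | zero =>
      have zero_smul_eq (y : M) : (0 : Env R) • y = 0 := zero_smul (Env R) y
      simp only [map_zero, zero_smul_eq, add_zero]
    | add t t' ht ht' =>
      simp only [add_smul, map_add, ht, ht']
      abel
    | tmul r s =>
      obtain ⟨s, rfl⟩ := op_surjective s
      rw [← leftHom_mul_rightHom, hδ.envDerivation, envDerivation_leftHom hδ,
        envDerivation_rightHom hδ]
      simp only [add_smul, mul_smul, hl, hr, hd.1, hd.2, smul_add, LinearMap.id_apply]
      abel
  · intro hd
    refine ⟨fun x r => ?_, fun r x => ?_⟩
    · simpa [envDerivation_rightHom hδ, hr, add_comm] using hd (rightHom (op r)) x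
    · simpa [envDerivation_leftHom hδ, hl] using hd (leftHom r) x

section Modules

variable {M : Type*} [AddCommGroup M] [Module R M] [Module Rᵐᵒᵖ M] [SMulCommClass R Rᵐᵒᵖ M]
  {Fl Fl₁ Fl₂ : IdealFilter R} {Fr Fr₁ Fr₂ : IdealFilter Rᵐᵒᵖ}
  [Fl.IsGabriel] [Fr.IsGabriel] [Fl₁.IsGabriel] [Fl₂.IsGabriel] [Fr₁.IsGabriel] [Fr₂.IsGabriel]

attribute [local instance] TensorProduct.Algebra.module

theorem isBimoduleDerivation_symQuot_iff (hδ : IsRingDerivation δ)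
    {d : SymQuot Fl Fr M →+ SymQuot Fl Fr M} :
    IsBimoduleDerivation δ d ↔
      IsDerivationAlong (C := ModQuot (symmetricFilter Fl Fr) M) (envDerivation δ) LinearMap.id d :=
  isBimoduleDerivation_iff (fun _ _ => rfl) (fun _ _ => rfl) hδ

theorem exists_extensionsAgree (h : symmetricFilter Fl₁ Fr₁ ≤ symmetricFilter Fl₂ Fr₂)
    (hδ : IsRingDerivation δ) {d : M →+ M} (hd : IsBimoduleDerivation δ d) :
    ∃ (d₁ : SymQuot Fl₁ Fr₁ M →+ SymQuot Fl₁ Fr₁ M)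
      (d₂ : SymQuot Fl₂ Fr₂ M →+ SymQuot Fl₂ Fr₂ M),
      IsBimoduleDerivation δ d₁ ∧ IsBimoduleDerivation δ d₂ ∧ ExtensionsAgree h d d₁ d₂ := by
  have hd' := (isBimoduleDerivation_iff (leftHom_smul M) (rightHom_smul M) hδ).mp hd
  obtain ⟨d₁, hd₁, h₁⟩ := exists_modQuot_derivation (F := symmetricFilter Fl₁ Fr₁)
    hδ.envDerivation hd'
  obtain ⟨d₂, hd₂, h₂⟩ := exists_modQuot_derivation (F := symmetricFilter Fl₂ Fr₂)
    hδ.envDerivation hd'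
  exact ⟨d₁, d₂, (isBimoduleDerivation_symQuot_iff hδ).mpr hd₁,
    (isBimoduleDerivation_symQuot_iff hδ).mpr hd₂,
    h₁, h₂, modQuot_derivations_agree h hd₁ hd₂ h₁ h₂⟩

end Modules

section Leibniz

variable {S : Type*} [Ring S]

/-- The failure `d (p q) - (d p q + p d q)` of the Leibniz rule for an additive map. -/
def leibnizDefect (d : S →+ S) (p q : S) : S := d (p * q) - (d p * q + p * d q)

variable [Module R S] [Module Rᵐᵒᵖ S] {d : S →+ S}

theorem leibnizDefect_smul_left [IsScalarTower R S S] (hd : IsBimoduleDerivation δ d) (r : R)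
    (p q : S) : leibnizDefect d (r • p) q = r • leibnizDefect d p q := by
  simp only [leibnizDefect, smul_mul_assoc, hd.2, add_mul, smul_sub, smul_add]
  abel

theorem leibnizDefect_smul_right [SMulCommClass Rᵐᵒᵖ S S] (hd : IsBimoduleDerivation δ d)
    (s : Rᵐᵒᵖ) (p q : S) : leibnizDefect d p (s • q) = s • leibnizDefect d p q := by
  obtain ⟨r, rfl⟩ := op_surjective s
  simp only [leibnizDefect, mul_smul_comm, hd.1, mul_add, smul_sub, smul_add]
  abel

theorem leibnizDefect_one_left (h : d 1 = 0) (q : S) : leibnizDefect d 1 q = 0 := by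
  simp [leibnizDefect, h]

theorem leibnizDefect_one_right (h : d 1 = 0) (p : S) : leibnizDefect d p 1 = 0 := by
  simp [leibnizDefect, h]

end Leibniz

section Ring

variable {Fl : IdealFilter R} {Fr : IdealFilter Rᵐᵒᵖ} [Fl.IsGabriel] [Fr.IsGabriel]

instance : IsScalarTower R (SymQuot Fl Fr R) (SymQuot Fl Fr R) := ⟨smul_mul_eq⟩

instance : SMulCommClass Rᵐᵒᵖ (SymQuot Fl Fr R) (SymQuot Fl Fr R) :=
  ⟨fun s p q => (mul_op_smul_eq s p q).symm⟩

theorem toSymQuot_eq_smul_one (r : R) : toSymQuot Fl Fr R r = r • 1 := by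
  rw [← toSymQuot_mul_eq, mul_one]

theorem toSymQuot_eq_op_smul_one (r : R) : toSymQuot Fl Fr R r = op r • 1 := by
  rw [← mul_toSymQuot_eq, one_mul]

theorem IsBimoduleDerivation.isRingDerivation {d : SymQuot Fl Fr R →+ SymQuot Fl Fr R}
    (hd : IsBimoduleDerivation δ d) (h : d 1 = 0) : IsRingDerivation d := by
  intro p q
  obtain ⟨I, hI, hp⟩ := exists_left_smul_mem p
  obtain ⟨J, hJ, hq⟩ := exists_right_smul_mem q
  refine sub_eq_zero.mp (sym_eq_zero (z := leibnizDefect d p q)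
    ⟨I, hI, fun a ha => ?_⟩ ⟨J, hJ, fun b hb => ?_⟩)
  · obtain ⟨r, hr⟩ := hp a ha
    rw [← leibnizDefect_smul_left hd, hr, toSymQuot_eq_smul_one, leibnizDefect_smul_left hd,
      leibnizDefect_one_left h, smul_zero]
  · obtain ⟨r, hr⟩ := hq b hb
    rw [← leibnizDefect_smul_right hd, hr, toSymQuot_eq_op_smul_one, leibnizDefect_smul_right hd,
      leibnizDefect_one_right h, smul_zero]

theorem map_one_eq_zero_of_extends {d : SymQuot Fl Fr R →+ SymQuot Fl Fr R}
    (hδ : IsRingDerivation δ) (h : ∀ r, d (toSymQuot Fl Fr R r) = toSymQuot Fl Fr R (δ r)) :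
    d 1 = 0 := by
  rw [sym_one_def, h, hδ.map_one_eq_zero, map_zero]

end Ring

end Bimodule

end TorsionQuotient

theorem mainTheorem8_general {R : Type*} [Ring R]
    (Fl₁ Fl₂ : IdealFilter R) (Fr₁ Fr₂ : IdealFilter Rᵐᵒᵖ)
    [Fl₁.IsGabriel] [Fl₂.IsGabriel] [Fr₁.IsGabriel] [Fr₂.IsGabriel]
    (h : symmetricFilter Fl₁ Fr₁ ≤ symmetricFilter Fl₂ Fr₂) :
    (∀ (M : Type*) [AddCommGroup M] [Module R M] [Module Rᵐᵒᵖ M] [SMulCommClass R Rᵐᵒᵖ M]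
        (δ : R →+ R) (d : M →+ M), IsRingDerivation δ → IsBimoduleDerivation δ d →
          ∃ (d₁ : SymQuot Fl₁ Fr₁ M →+ SymQuot Fl₁ Fr₁ M)
            (d₂ : SymQuot Fl₂ Fr₂ M →+ SymQuot Fl₂ Fr₂ M),
            IsBimoduleDerivation δ d₁ ∧ IsBimoduleDerivation δ d₂ ∧ ExtensionsAgree h d d₁ d₂) ∧
      ∀ δ : R →+ R, IsRingDerivation δ →
        ∃ (d₁ : SymQuot Fl₁ Fr₁ R →+ SymQuot Fl₁ Fr₁ R)
          (d₂ : SymQuot Fl₂ Fr₂ R →+ SymQuot Fl₂ Fr₂ R),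
          IsRingDerivation d₁ ∧ IsRingDerivation d₂ ∧
          IsBimoduleDerivation δ d₁ ∧ IsBimoduleDerivation δ d₂ ∧
          ExtensionsAgree h δ d₁ d₂ := by
  refine ⟨fun M _ _ _ _ δ d hδ hd => exists_extensionsAgree h hδ hd, fun δ hδ => ?_⟩
  have hδ' : IsBimoduleDerivation δ δ := ⟨hδ, hδ⟩
  obtain ⟨d₁, d₂, hd₁, hd₂, hagree⟩ := exists_extensionsAgree h hδ hδ'
  have map_one₁ : d₁ 1 = 0 := map_one_eq_zero_of_extends hδ hagree.extends_first
  have map_one₂ : d₂ 1 = 0 := map_one_eq_zero_of_extends hδ hagree.extends_second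
  exact ⟨d₁, d₂, hd₁.isRingDerivation map_one₁, hd₂.isRingDerivation map_one₂, hd₁, hd₂, hagree⟩

theorem mainTheorem8 {R : Type*} [Ring R]
    (Fl₁ Fl₂ : IdealFilter R) (Fr₁ Fr₂ : IdealFilter Rᵐᵒᵖ)
    [Fl₁.IsGabriel] [Fl₂.IsGabriel] [Fr₁.IsGabriel] [Fr₂.IsGabriel]
    (h : symmetricFilter Fl₁ Fr₁ ≤ symmetricFilter Fl₂ Fr₂) :
    (SymDifferential Fl₁ Fr₁ →
      ∀ (M : Type*) [AddCommGroup M] [Module R M] [Module Rᵐᵒᵖ M] [SMulCommClass R Rᵐᵒᵖ M],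
        SymTorsionFree Fl₂ Fr₂ (SymQuot Fl₁ Fr₁ M) ∨ SymDifferential Fl₂ Fr₂ →
        ∀ (δ : R →+ R) (d : M →+ M), IsRingDerivation δ → IsBimoduleDerivation δ d →
          ∃ (d₁ : SymQuot Fl₁ Fr₁ M →+ SymQuot Fl₁ Fr₁ M)
            (d₂ : SymQuot Fl₂ Fr₂ M →+ SymQuot Fl₂ Fr₂ M),
            IsBimoduleDerivation δ d₁ ∧ IsBimoduleDerivation δ d₂ ∧ ExtensionsAgree h d d₁ d₂) ∧
    ((SymDifferential Fl₁ Fr₁ ∧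
          (SymTorsionFree Fl₂ Fr₂ (SymQuot Fl₁ Fr₁ R) ∨ SymDifferential Fl₂ Fr₂)) ∨
        (SymFaithful Fl₁ Fr₁ ∧ SymFaithful Fl₂ Fr₂) →
      ∀ δ : R →+ R, IsRingDerivation δ →
        ∃ (d₁ : SymQuot Fl₁ Fr₁ R →+ SymQuot Fl₁ Fr₁ R)
          (d₂ : SymQuot Fl₂ Fr₂ R →+ SymQuot Fl₂ Fr₂ R),
          IsRingDerivation d₁ ∧ IsRingDerivation d₂ ∧
          IsBimoduleDerivation δ d₁ ∧ IsBimoduleDerivation δ d₂ ∧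
          ExtensionsAgree h δ d₁ d₂) :=
  have ⟨bimodule_extension, ring_extension⟩ := mainTheorem8_general Fl₁ Fl₂ Fr₁ Fr₂ h
  ⟨fun _ M _ _ _ _ _ => bimodule_extension M, fun _ => ring_extension⟩
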